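/- Theorem 5.1. Let $F$ be a field of characteristic $0$. For a (not necessarily associative, not necessarily unital) algebra $A$ over $F$ consider the commutator $[a,b]=ab-ba$, the associator $(a,b,c)=(ab)c-a(bc)$ and the first quaternator $\langle a,b,c,d\rangle=(ab,c,d)-a(b,c,d)-(a,c,d)b$. Call $A$ power associative if every subalgebra of $A$ generated by one element is associative. A BTQ algebra over $F$ is an $F$-vector space $B$ with a bilinear operation $[a,b]$, a trilinear operation $(a,b,c)$ and a quadrilinear operation $\langle a,b,c,d\rangle$ such that for all $a,b,c,d\in B$ \begin{align*} &[a,b]=-[b,a],\\ &(a,b,c)+(a,c,b)+(b,a,c)+(b,c,a)+(c,a,b)+(c,b,a)=0,\\ &[[a,b],c]+[[b,c],a]+[[c,a],b]=2(a,b,c)+2(b,c,a)+2(c,a,b),\\ &[(a,b,c),d]-[(d,b,c),a]-([a,d],b,c)+\langle a,d,b,c\rangle-\langle d,a,b,c\rangle=0,\\ &(a,[b,c],d)-(a,[b,d],c)+(a,[c,d],b)-(a,b,[c,d])+(a,c,[b,d])-(a,d,[b,c])\\ &\quad-\langle a,b,c,d\rangle+\langle a,b,d,c\rangle+\langle a,c,b,d\rangle-\langle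 a,c,d,b\rangle-\langle a,d,b,c\rangle+\langle a,d,c,b\rangle=0,\\ &[(a,b,c),d]-[(a,d,c),b]-[(c,b,a),d]+[(c,d,a),b]+[(b,a,d),c]-[(b,c,d),a]\\ &\quad-[(d,a,b),c]+[(d,c,b),a]-([a,b],c,d)-([a,d],b,c)-([c,b],d,a)-([c,d],a,b)\\ &\quad-(a,[c,b],d)-(c,[a,d],b)-(b,[c,d],a)-(d,[a,b],c)-(a,b,[c,d])-(c,d,[a,b])\\ &\quad-(b,c,[a,d])-(d,a,[c,b])=0,\\ &\sum_{\pi}\langle a^\pi,b^\pi,c^\pi,d^\pi\rangle=0\quad\text{($\pi$ running over all permutations of $a,b,c,d$)}. \end{align*} Then the identity $$[(a,[a,b],a),a]-[\langle a,a,a,b\rangle,a]+[\langle a,b,a,a\rangle,a]\equiv 0$$ is satisfied by the commutator, associator and first quaternator in every power associative algebra over $F$, but it is not a consequence of the defining identities of BTQ algebras: there is a BTQ algebra over $F$ in which it fails for some elements $a,b$. -/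

import Mathlib

universe u v

/-- A (not necessarily unital) nonassociative algebra `A` over `F` is power associative when the
subalgebra generated by any single element is associative. -/
def IsPowerAssociative (F : Type u) (A : Type v) [Field F] [NonUnitalNonAssocRing A]
    [Module F A] [IsScalarTower F A A] [SMulCommClass F A A] : Prop :=
  ∀ a : A, ∀ x ∈ NonUnitalAlgebra.adjoin F {a}, ∀ y ∈ NonUnitalAlgebra.adjoin F {a},
    ∀ z ∈ NonUnitalAlgebra.adjoin F {a}, (x * y) * z = x * (y * z)

/-- A vector space `B` with a bilinear operation `[a, b]`, a trilinear operation `(a, b, c)` and a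
quadrilinear operation `⟨a, b, c, d⟩`; no identities are imposed. -/
structure BTQOperations (F : Type u) (B : Type v) [Field F] [AddCommGroup B] [Module F B] where
  /-- the bilinear operation `[a, b]` -/
  br : B →ₗ[F] B →ₗ[F] B
  /-- the trilinear operation `(a, b, c)` -/
  tr : B →ₗ[F] B →ₗ[F] B →ₗ[F] B
  /-- the quadrilinear operation `⟨a, b, c, d⟩` -/
  qu : B →ₗ[F] B →ₗ[F] B →ₗ[F] B →ₗ[F] B

namespace BTQOperations

section Identities

variable {F : Type u} {B : Type v} [Field F] [AddCommGroup B] [Module F B]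

/-- The defining identities of BTQ algebras: anticommutativity, the two identities of degree 3
and the four identities of degree 4. -/
structure IsBTQ (O : BTQOperations F B) : Prop where
  anticomm : ∀ a b, O.br a b = -O.br b a
  deg3_first : ∀ a b c,
    O.tr a b c + O.tr a c b + O.tr b a c + O.tr b c a + O.tr c a b + O.tr c b a = 0
  deg3_second : ∀ a b c,
    O.br (O.br a b) c + O.br (O.br b c) a + O.br (O.br c a) b
      = (2 : F) • O.tr a b c + (2 : F) • O.tr b c a + (2 : F) • O.tr c a b
  deg4_first : ∀ a b c d,
    O.br (O.tr a b c) d - O.br (O.tr d b c) a - O.tr (O.br a d) b c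
      + O.qu a d b c - O.qu d a b c = 0
  deg4_second : ∀ a b c d,
    O.tr a (O.br b c) d - O.tr a (O.br b d) c + O.tr a (O.br c d) b
      - O.tr a b (O.br c d) + O.tr a c (O.br b d) - O.tr a d (O.br b c)
      - O.qu a b c d + O.qu a b d c + O.qu a c b d
      - O.qu a c d b - O.qu a d b c + O.qu a d c b = 0
  deg4_third : ∀ a b c d,
    O.br (O.tr a b c) d - O.br (O.tr a d c) b - O.br (O.tr c b a) d + O.br (O.tr c d a) b
      + O.br (O.tr b a d) c - O.br (O.tr b c d) a - O.br (O.tr d a b) c + O.br (O.tr d c b) a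
      - O.tr (O.br a b) c d - O.tr (O.br a d) b c - O.tr (O.br c b) d a - O.tr (O.br c d) a b
      - O.tr a (O.br c b) d - O.tr c (O.br a d) b - O.tr b (O.br c d) a - O.tr d (O.br a b) c
      - O.tr a b (O.br c d) - O.tr c d (O.br a b) - O.tr b c (O.br a d) - O.tr d a (O.br c b)
      = 0
  deg4_fourth : ∀ v : Fin 4 → B,
    ∑ π : Equiv.Perm (Fin 4), O.qu (v (π 0)) (v (π 1)) (v (π 2)) (v (π 3)) = 0

/-- The operations satisfy the identity
`[(a, [a, b], a), a] - [⟨a, a, a, b⟩, a] + [⟨a, b, a, a⟩, a] ≡ 0`. -/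
def SatisfiesNewIdentity (O : BTQOperations F B) : Prop :=
  ∀ a b : B,
    O.br (O.tr a (O.br a b) a) a - O.br (O.qu a a a b) a + O.br (O.qu a b a a) a = 0

end Identities

section OfAlgebra

variable (F : Type u) (A : Type v) [Field F] [NonUnitalNonAssocRing A]
  [Module F A] [IsScalarTower F A A] [SMulCommClass F A A]

/-- The commutator `ab - ba`, the associator `(a,b,c) = (ab)c - a(bc)` and the first quaternator
`(ab,c,d) - a(b,c,d) - (a,c,d)b` of a nonassociative algebra. -/
def ofAlgebra : BTQOperations F A where
  br := LinearMap.mk₂ F (fun a b => a * b - b * a)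
    (by intros; simp only [add_mul, mul_add]; abel)
    (by intros; simp only [smul_mul_assoc, mul_smul_comm, smul_sub])
    (by intros; simp only [add_mul, mul_add]; abel)
    (by intros; simp only [smul_mul_assoc, mul_smul_comm, smul_sub])
  tr := LinearMap.mk₂ F
    (fun a b =>
      { toFun := fun c => associator a b c
        map_add' := by intros; simp only [associator, mul_add]; abel
        map_smul' := by
          intros; simp only [associator, mul_smul_comm, smul_sub, RingHom.id_apply] })
    (by
      intros; ext
      simp only [associator, add_mul, LinearMap.coe_mk, AddHom.coe_mk, LinearMap.add_apply]
      abel)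
    (by
      intros; ext
      simp only [associator, smul_mul_assoc, smul_sub, LinearMap.coe_mk, AddHom.coe_mk,
        LinearMap.smul_apply])
    (by
      intros; ext
      simp only [associator, add_mul, mul_add, LinearMap.coe_mk, AddHom.coe_mk,
        LinearMap.add_apply]
      abel)
    (by
      intros; ext
      simp only [associator, smul_mul_assoc, mul_smul_comm, smul_sub, LinearMap.coe_mk,
        AddHom.coe_mk, LinearMap.smul_apply])
  qu := LinearMap.mk₂ F
    (fun a b => LinearMap.mk₂ F
      (fun c d => associator (a * b) c d - a * associator b c d - associator a c d * b)
      (by intros; simp only [associator, add_mul, mul_add, sub_mul, mul_sub]; abel)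
      (by
        intros
        simp only [associator, smul_mul_assoc, mul_smul_comm, smul_sub, sub_mul, mul_sub])
      (by intros; simp only [associator, add_mul, mul_add, sub_mul, mul_sub]; abel)
      (by
        intros
        simp only [associator, smul_mul_assoc, mul_smul_comm, smul_sub, sub_mul, mul_sub]))
    (by
      intros; ext
      simp only [associator, add_mul, mul_add, sub_mul, mul_sub, LinearMap.mk₂_apply,
        LinearMap.add_apply]
      abel)
    (by
      intros; ext
      simp only [associator, smul_mul_assoc, mul_smul_comm, smul_sub, sub_mul, mul_sub,
        LinearMap.mk₂_apply, LinearMap.smul_apply])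
    (by
      intros; ext
      simp only [associator, add_mul, mul_add, sub_mul, mul_sub, LinearMap.mk₂_apply,
        LinearMap.add_apply]
      abel)
    (by
      intros; ext
      simp only [associator, smul_mul_assoc, mul_smul_comm, smul_sub, sub_mul, mul_sub,
        LinearMap.mk₂_apply, LinearMap.smul_apply])

variable {A}

theorem ofAlgebra_br (a b : A) : (ofAlgebra F A).br a b = a * b - b * a := rfl

theorem ofAlgebra_tr (a b c : A) : (ofAlgebra F A).tr a b c = (a * b) * c - a * (b * c) := rfl

theorem ofAlgebra_qu (a b c d : A) : (ofAlgebra F A).qu a b c d =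
    ((ofAlgebra F A).tr (a * b) c d) - a * (ofAlgebra F A).tr b c d
      - (ofAlgebra F A).tr a c d * b := rfl

end OfAlgebra

end BTQOperations

/-!
The positive half is a matter of linearization. In a power associative algebra the cubic form
`(x, x, x)` vanishes identically, hence so do its partial linearization
`linAssoc a w = (a, a, w) + (a, w, a) + (w, a, a)` and its full linearization
`symAssoc`, the sum of the associator over all orders of its arguments. Likewise `(x², x, x) = 0`
linearizes to `linAssocSq a w = 0`. In degree 5, five times the new identity is an integer
combination of these linearizations, modulo associativity of the powers of `a`
(`five_nsmul_newIdentity`); characteristic `0` is used to divide by the integers that occur.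

For the negative half, take `F⁴` with basis `a, b, c, d`, where a product of basis vectors is zero
unless all its factors but one are equal to `a`. For such operations, with the trilinear one zero,
the identities of degree 4 only involve products of one vector with three copies of `a`; they ask
for symmetry of the quaternator in its first two arguments and for the vanishing of its
symmetrization, and both leave room for `⟨a, a, a, b⟩ = -⟨a, a, b, a⟩ = c` with `⟨a, b, a, a⟩ = 0`.
Nothing prevents `[c, a] = -d` from being nonzero, and then the identity fails (`witness`).
-/

/-! ### Linearizations of power associativity -/

section Linearization

variable {A : Type v} [NonUnitalNonAssocRing A]

/-- The part of `(x, x, x)` at `x = a + w` that is linear in `w`. -/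
def linAssoc (a w : A) : A :=
  associator a a w + associator a w a + associator w a a

/-- The sum of the associator over all orders of its three arguments. -/
def symAssoc (x y z : A) : A :=
  associator x y z + associator x z y + associator y x z + associator y z x
    + associator z x y + associator z y x

/-- The part of `(x², x, x)` at `x = a + w` that is linear in `w`. -/
def linAssocSq (a w : A) : A :=
  associator (a * w) a a + associator (w * a) a a + associator (a * a) w a
    + associator (a * a) a w

theorem two_nsmul_linAssoc (a w : A) :
    2 • linAssoc a w = associator (a + w) (a + w) (a + w) - associator (a - w) (a - w) (a - w)
      - 2 • associator w w w := by
  simp only [linAssoc, associator, add_mul, mul_add, sub_mul, mul_sub]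
  abel

theorem symAssoc_eq (x y z : A) :
    symAssoc x y z = linAssoc (x + y) z - linAssoc x z - linAssoc y z := by
  simp only [symAssoc, linAssoc, associator, add_mul, mul_add]
  abel

/-- The linear coefficient of the quartic polynomial `t ↦ ((a + t w)², a + t w, a + t w)`, from its
values at `t = ±1, ±2`. -/
theorem twelve_nsmul_linAssocSq (a w : A) :
    let g : A → A := fun x => associator (x * x) x x
    12 • linAssocSq a w = 8 • (g (a + w) - g (a - w)) - (g (a + (w + w)) - g (a - (w + w))) := by
  simp only [linAssocSq, associator, add_mul, mul_add, sub_mul, mul_sub]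
  abel

/-- Five times the left-hand side of the new identity, for an element `a` with associative powers,
as a combination of linearizations of `(x, x, x)` and `(x², x, x)`. The coefficients solve the
linear system given by the monomials of degree four in `a` and one in `b`. -/
theorem five_nsmul_newIdentity (a b : A) (h₃ : a * (a * a) = a * a * a)
    (h₄ : a * a * (a * a) = a * a * a * a) (h₄' : a * (a * a * a) = a * a * a * a) :
    let br : A → A → A := fun x y => x * y - y * x
    let qu : A → A → A → A → A := fun x y z w =>
      associator (x * y) z w - x * associator y z w - associator x z w * y
    5 • (br (associator a (br a b) a) a - br (qu a a a b) a + br (qu a b a a) a) =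
      3 • br (linAssoc a b * a) a + br a (linAssocSq a b) - 4 • br a (linAssoc a (a * b))
        + br a (linAssoc a (b * a)) + br a (symAssoc a (a * a) b)
        - symAssoc a (a * a) (a * b + b * a) + 4 • linAssoc a (a * a * b + b * (a * a))
        + 4 • linAssoc (a * a) b - 2 • symAssoc a (a * a * a) b
        - linAssoc a (a * (a * b + b * a) + (a * b + b * a) * a) := by
  simp only [linAssoc, linAssocSq, symAssoc, associator, add_mul, mul_add, sub_mul, mul_sub,
    h₃, h₄, h₄']
  abel

end Linearization

namespace BTQOperations

/-! ### The identity in power associative algebras -/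

theorem satisfiesNewIdentity_ofAlgebra {F : Type u} {A : Type v} [Field F] [CharZero F]
    [NonUnitalNonAssocRing A] [Module F A] [IsScalarTower F A A] [SMulCommClass F A A]
    (h : IsPowerAssociative F A) : (ofAlgebra F A).SatisfiesNewIdentity := by
  have self (x : A) : x ∈ NonUnitalAlgebra.adjoin F {x} :=
    NonUnitalAlgebra.subset_adjoin F (Set.mem_singleton x)
  have sq (x : A) : x * x ∈ NonUnitalAlgebra.adjoin F {x} := mul_mem (self x) (self x)
  have h₃ (x : A) : associator x x x = 0 :=
    sub_eq_zero.2 (h x x (self x) x (self x) x (self x))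
  have h₄ (x : A) : associator (x * x) x x = 0 :=
    sub_eq_zero.2 (h x _ (sq x) x (self x) x (self x))
  have cancel (n : ℕ) [n.AtLeastTwo] {x : A} (hx : (OfNat.ofNat n : ℕ) • x = 0) : x = 0 := by
    rw [← Nat.cast_smul_eq_nsmul F] at hx
    exact (smul_eq_zero.1 hx).resolve_left (Nat.cast_ne_zero.2 (NeZero.ne n))
  have lin (a w : A) : linAssoc a w = 0 :=
    cancel 2 <| by rw [two_nsmul_linAssoc]; simp only [h₃, smul_zero, sub_zero]
  have sym (x y z : A) : symAssoc x y z = 0 := by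
    simp only [symAssoc_eq, lin, sub_zero]
  have linSq (a w : A) : linAssocSq a w = 0 :=
    cancel 12 <| by rw [twelve_nsmul_linAssocSq]; simp only [h₄, smul_zero, sub_zero]
  intro a b
  refine cancel 5 ((five_nsmul_newIdentity a b ?_ ?_ ?_).trans ?_)
  · exact (h a a (self a) a (self a) a (self a)).symm
  · exact (h a _ (sq a) a (self a) a (self a)).symm
  · rw [← h a a (self a) _ (sq a) a (self a), ← h a a (self a) a (self a) a (self a)]
  · simp only [lin, sym, linSq, zero_mul, mul_zero, smul_zero, sub_zero, add_zero]

/-! ### A BTQ algebra violating the identity -/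

/-- On `F⁴` with basis `a, b, c, d`: the bracket with `[a, c] = d = -[c, a]`, the zero trilinear
operation, and the quadrilinear operation with `⟨a, a, a, b⟩ = c = -⟨a, a, b, a⟩`; all other
products of basis vectors are zero. -/
def witness (F : Type u) [Field F] : BTQOperations F (Fin 4 → F) where
  br := LinearMap.mk₂ F (fun x y => (x 0 * y 2 - x 2 * y 0) • Pi.single 3 1)
    (by intros; rw [← add_smul]; congr 1; simp only [Pi.add_apply]; ring)
    (by intros; rw [smul_smul]; congr 1; simp only [Pi.smul_apply, smul_eq_mul]; ring)
    (by intros; rw [← add_smul]; congr 1; simp only [Pi.add_apply]; ring)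
    (by intros; rw [smul_smul]; congr 1; simp only [Pi.smul_apply, smul_eq_mul]; ring)
  tr := 0
  qu := LinearMap.mk₂ F
    (fun x y => LinearMap.mk₂ F
      (fun z w => (x 0 * y 0 * (z 0 * w 1 - z 1 * w 0)) • Pi.single 2 1)
      (by intros; rw [← add_smul]; congr 1; simp only [Pi.add_apply]; ring)
      (by intros; rw [smul_smul]; congr 1; simp only [Pi.smul_apply, smul_eq_mul]; ring)
      (by intros; rw [← add_smul]; congr 1; simp only [Pi.add_apply]; ring)
      (by intros; rw [smul_smul]; congr 1; simp only [Pi.smul_apply, smul_eq_mul]; ring))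
    (by
      intros; refine LinearMap.ext₂ fun z w => ?_
      simp only [LinearMap.mk₂_apply, LinearMap.add_apply, ← add_smul, Pi.add_apply, add_mul])
    (by
      intros; refine LinearMap.ext₂ fun z w => ?_
      simp only [LinearMap.mk₂_apply, LinearMap.smul_apply, smul_smul, Pi.smul_apply,
        smul_eq_mul, mul_assoc])
    (by
      intros; refine LinearMap.ext₂ fun z w => ?_
      simp only [LinearMap.mk₂_apply, LinearMap.add_apply, ← add_smul, Pi.add_apply, mul_add,
        add_mul])
    (by
      intros; refine LinearMap.ext₂ fun z w => ?_
      simp only [LinearMap.mk₂_apply, LinearMap.smul_apply, smul_smul, Pi.smul_apply,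
        smul_eq_mul, mul_assoc, mul_left_comm])

variable {F : Type u} [Field F]

theorem witness_br (x y : Fin 4 → F) :
    (witness F).br x y = (x 0 * y 2 - x 2 * y 0) • Pi.single 3 1 := rfl

theorem witness_tr (x y z : Fin 4 → F) : (witness F).tr x y z = 0 := rfl

theorem witness_qu (x y z w : Fin 4 → F) :
    (witness F).qu x y z w = (x 0 * y 0 * (z 0 * w 1 - z 1 * w 0)) • Pi.single 2 1 := rfl

theorem witness_br_br (x y z : Fin 4 → F) :
    (witness F).br ((witness F).br x y) z = 0 := by
  simp [witness_br]

theorem isBTQ_witness : (witness F).IsBTQ where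
  anticomm x y := by
    rw [witness_br, witness_br, ← neg_smul]
    congr 1
    ring
  deg3_first x y z := by simp only [witness_tr, add_zero]
  deg3_second x y z := by simp only [witness_br_br, witness_tr, smul_zero, add_zero]
  deg4_first x y z w := by
    simp only [witness_tr, map_zero, LinearMap.zero_apply, zero_add, witness_qu, mul_comm (x 0),
      sub_self]
  deg4_second x y z w := by
    simp only [witness_tr, sub_zero, add_zero, zero_sub, witness_qu, ← add_smul, ← sub_smul,
      ← neg_smul]
    convert zero_smul F _
    ring
  deg4_third x y z w := by
    simp only [witness_tr, map_zero, LinearMap.zero_apply, sub_zero, add_zero]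
  deg4_fourth v := by
    -- Exchanging the last two arguments changes the sign of the terms and permutes the sum.
    refine Finset.sum_involution (fun π _ => π * Equiv.swap 2 3) (fun π _ => ?_)
      (fun π _ _ hπ => ?_) (fun _ _ => Finset.mem_univ _) (fun π _ => ?_)
    · have h₀ : Equiv.swap (2 : Fin 4) 3 0 = 0 := by decide
      have h₁ : Equiv.swap (2 : Fin 4) 3 1 = 1 := by decide
      simp only [witness_qu, Equiv.Perm.mul_apply, h₀, h₁, Equiv.swap_apply_left,
        Equiv.swap_apply_right, ← add_smul]
      convert zero_smul F _
      ring
    · exact absurd (mul_eq_left.1 hπ) (by decide)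
    · rw [mul_assoc, Equiv.swap_mul_self, mul_one]

theorem not_satisfiesNewIdentity_witness : ¬ (witness F).SatisfiesNewIdentity := fun h => by
  have := congrFun (h (Pi.single 0 1) (Pi.single 1 1)) 3
  simp [witness_br, witness_qu] at this

end BTQOperations

theorem theorem5p1 (F : Type u) [Field F] [CharZero F] :
    (∀ (A : Type v) [NonUnitalNonAssocRing A] [Module F A] [IsScalarTower F A A]
        [SMulCommClass F A A],
        IsPowerAssociative F A → (BTQOperations.ofAlgebra F A).SatisfiesNewIdentity) ∧
      (∃ (B : Type u) (_ : AddCommGroup B) (_ : Module F B) (O : BTQOperations F B),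
        O.IsBTQ ∧ ¬ O.SatisfiesNewIdentity) :=
  ⟨fun _ _ _ _ _ h => BTQOperations.satisfiesNewIdentity_ofAlgebra h,
    Fin 4 → F, inferInstance, inferInstance, BTQOperations.witness F,
    BTQOperations.isBTQ_witness, BTQOperations.not_satisfiesNewIdentity_witness⟩
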